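/- Let $T$ be a complete first-order theory in a language $L$, let $\tau=|T|=\max(\aleph_0,|L|)$, and let $\mu\le\tau$ be a finite or infinite cardinal. For a cardinal $\kappa>\tau$, call $T$ $(\mu,\kappa)$-almost indiscernible if it has a saturated model $M$ of cardinality $\kappa$ that is the algebraic closure of (the set of all entries of members of) an indiscernible set $I$ of $\mu$-sequences from $M$. Here $I$ is an indiscernible set if, for each $n$, all $n$-tuples of distinct members of $I$ have the same type over $\emptyset$. (a) The following are equivalent: (i) $T$ is $(\mu,\kappa)$-almost indiscernible for some $\kappa>\tau$; (ii) $T$ is $(\mu,\tau^+)$-almost indiscernible; (iii) $T$ is $(\mu,\kappa')$-almost indiscernible for all $\kappa'>\tau$. (b) Suppose that $M$ and $I$ witness that $T$ is $(\mu,\kappa)$-almost indiscernible for some $\kappa>\tau$. Then $|I|=\kappa$, and for every sequence $(e_\alpha)_{\alpha<\tau}$ of distinct elements of $I$ the set $M_\tau=\operatorname{acl}(\{e_{\alpha,i} : \alpha<\tau,\ i<\mu\})$ is (the universe of) an elementary substructure of $M$ which is a saturated model of $T$ of cardinality $\tau$. In particular, $M_\tau$ is a saturated model of $T$ that is the algebraic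 closure of an indiscernible sequence of length $\tau$ of distinct $\mu$-tuples. -/

import Mathlib

universe u v w x y

namespace AlmInd

open FirstOrder Cardinal

/-- The cardinality `|T|` of a complete theory in the language `L`: the number of `L`-sentences,
that is, `max ℵ₀ |L|`. -/
noncomputable def theoryCard (L : FirstOrder.Language.{u, v}) : Cardinal.{max u v} :=
  max ℵ₀ L.card

/-- The model-theoretic algebraic closure of `A` in the structure `M`: the union of all
finite subsets of `M` that are definable with parameters from `A`. -/
def acl (L : FirstOrder.Language.{u, v}) {M : Type w} [L.Structure M] (A : Set M) : Set M :=
  {a | ∃ S : Set M, A.Definable₁ L S ∧ S.Finite ∧ a ∈ S}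

/-- `M` is saturated: for every `A ⊆ M` with `|A| < |M|`, every `1`-type over `A`
(a set of formulas over `A` in one variable, finitely satisfiable in `M`) is realized in `M`. -/
def IsSaturated (L : FirstOrder.Language.{u, v}) (M : Type w) [L.Structure M] : Prop :=
  ∀ A : Set M, #A < #M → ∀ p : Set (L[[A]].Formula (Fin 1)),
    (∀ q : Finset (L[[A]].Formula (Fin 1)), (q : Set (L[[A]].Formula (Fin 1))) ⊆ p →
      ∃ a : Fin 1 → M, ∀ φ ∈ q, φ.Realize a) →
    ∃ a : Fin 1 → M, ∀ φ ∈ p, φ.Realize a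

/-- A family `(e i)` of (possibly infinite) tuples, each indexed by `β`, is totally indiscernible
over `∅`: for every `n`, any two `n`-tuples of distinct indices give rise to
`n`-tuples of tuples with the same type. -/
def IsIndiscernible (L : FirstOrder.Language.{u, v}) {M : Type w} [L.Structure M]
    {ι : Type x} {β : Type y} (e : ι → β → M) : Prop :=
  ∀ (n : ℕ) (f g : Fin n ↪ ι) (φ : L.Formula (Fin n × β)),
    φ.Realize (fun p => e (f p.1) p.2) ↔ φ.Realize (fun p => e (g p.1) p.2)

/-- All entries of the tuples of a family. -/
def entries {M : Type w} {ι : Type x} {β : Type y} (e : ι → β → M) : Set M :=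
  {a | ∃ i b, e i b = a}

/-- `M` is a saturated model of `T` of cardinality `κ`, and `I` is an indiscernible set of
`μ`-sequences (functions on the ordinals below the initial ordinal of `μ`) in `M`
such that `M` is the algebraic closure of `I`. -/
structure Witnesses {L : FirstOrder.Language.{u, v}} (T : L.Theory) (μ κ : Cardinal.{w})
    (M : Type w) [L.Structure M] (I : Set (μ.ord.ToType → M)) : Prop where
  model : M ⊨ T
  card_eq : #M = κ
  saturated : IsSaturated L M
  indiscernible : IsIndiscernible L (fun i : I => i.1)
  acl_eq : acl L (entries (fun i : I => i.1)) = Set.univ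

/-- `T` is `(μ, κ)`-almost indiscernible (to be used for `T` complete, `μ ≤ |T| < κ`). -/
def IsAlmostIndiscernible {L : FirstOrder.Language.{u, v}} (T : L.Theory) (μ κ : Cardinal.{w}) : Prop :=
  ∃ (M : Type w) (_ : L.Structure M) (I : Set (μ.ord.ToType → M)), Witnesses T μ κ M I

end AlmInd

/-! Write `acl(J)` for the closure of the members of the indiscernible family with index in `J`. The
basic tool is that the family stays totally indiscernible over `acl(J)` when the complement of `J`
is infinite (`sameType_over_aclOn`). A finite tuple of `acl(J)` lies in a finite set definable over
`J`, and among infinitely many disjoint fresh blocks of indices two must treat that set alike. By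
total indiscernibility any two disjoint blocks then do. Since elementary maps extend to algebraic
closures, every element of the model can be moved over `acl(J)` into `acl(J ∪ C)`, with `C` a finite
subset of any prescribed infinite set outside `J` (`exists_sameOver_aclOn`).

For infinite `J`, this gives the Tarski–Vaught test for `acl(J)`. It also gives saturation of
`acl(J)` when `|J| ≥ τ`: a small parameter set lies in some `acl(J₀)` with `|J₀| < |J|`, the type is
realized in the saturated model because `|acl(J₀)| < κ`, and the realization is moved into `acl(J)`.
This proves (b) and the passage to smaller cardinals.

For larger cardinals the family is stretched by an ultrapower. Closures of countable index sets lie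
inside elementary copies of the original model, so types over them are realized. The passage to
arbitrary co-infinite index sets (`exists_realizesOn_of_countable`) is a finite-character argument:
were it to fail, a chain of countable sets would witness the failure of successive realizations, yet
a realization over the union of the chain has finite support and, by `SameOver.extend`, agrees with
an earlier one. -/

namespace AlmInd

open FirstOrder Cardinal Language Filter

/-! ### Partial elementary maps and algebraic elements -/

section SameType

variable {L : FirstOrder.Language.{u, v}} {M N : Type w} [L.Structure M] [L.Structure N]
  {α β γ δ : Type*}

variable (L) in
/-- Two families, in possibly different structures, have the same type: they satisfy the same
formulas. Equivalently, `a i ↦ b i` is a partial elementary map. -/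
def SameType (a : α → M) (b : α → N) : Prop :=
  ∀ φ : L.Formula α, φ.Realize a ↔ φ.Realize b

theorem SameType.symm {a : α → M} {b : α → N} (h : SameType L a b) : SameType L b a :=
  fun φ => (h φ).symm

theorem SameType.trans {P : Type w} [L.Structure P] {a : α → M} {b : α → N} {c : α → P}
    (h : SameType L a b) (h' : SameType L b c) : SameType L a c :=
  fun φ => (h φ).trans (h' φ)

theorem SameType.comp {a : α → M} {b : α → N} (h : SameType L a b) (f : β → α) :
    SameType L (a ∘ f) (b ∘ f) := fun φ => by
  simpa [Formula.realize_relabel] using h (φ.relabel f)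

theorem SameType.of_imp {a : α → M} {b : α → N}
    (h : ∀ φ : L.Formula α, φ.Realize a → φ.Realize b) : SameType L a b := fun φ =>
  ⟨h φ, fun hb => by
    by_contra ha
    exact (Formula.realize_not.1 (h φ.not (Formula.realize_not.2 ha))) hb⟩

theorem SameType.eq_iff {a : α → M} {b : α → N} (h : SameType L a b) (i j : α) :
    a i = a j ↔ b i = b j := by
  simpa [Formula.realize_equal] using h ((Term.var i).equal (Term.var j))

theorem sameType_embedding (g : M ↪ₑ[L] N) (a : α → M) : SameType L a (g ∘ a) :=
  fun φ => (g.map_formula φ a).symm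

/-- A formula depends on only finitely many variables. -/
theorem exists_finset_support (φ : L.Formula (α ⊕ γ)) :
    ∃ (s : Finset γ) (ψ : L.Formula (α ⊕ s)), ∀ (M : Type w) [L.Structure M] (a : α → M)
      (c : γ → M), ψ.Realize (Sum.elim a (fun i : s => c i)) ↔ φ.Realize (Sum.elim a c) := by
  classical
  refine ⟨φ.freeVarFinset.toRight, φ.restrictFreeVar (fun x => Sum.casesOn x.1
        (fun x _ => Sum.inl x) (fun x hx => Sum.inr ⟨x, by simpa using hx⟩) x.2), ?_⟩
  intro M _ a c
  refine BoundedFormula.realize_restrictFreeVar _ ?_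
  rintro ⟨x | x, hx⟩ <;> rfl

/-- To compare types of families it suffices to compare finite parts of one block of variables. -/
theorem SameType.of_finset {a : α → M} {b : α → N} {c : γ → M} {d : γ → N}
    (h : ∀ s : Finset γ, SameType L (Sum.elim a (fun i : s => c i))
      (Sum.elim b (fun i : s => d i))) : SameType L (Sum.elim a c) (Sum.elim b d) := fun φ => by
  obtain ⟨s, ψ, hψ⟩ := exists_finset_support φ
  rw [← hψ M a c, ← hψ N b d]
  exact h s ψ

/-- The formula stating that `φ` has at least `n` solutions in its last variable. -/
noncomputable def atLeast (φ : L.Formula (α ⊕ Unit)) (n : ℕ) : L.Formula α :=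
  Formula.iExs (Fin n) ((Formula.iInf fun i : Fin n =>
      φ.relabel (Sum.elim Sum.inl fun _ => Sum.inr i)) ⊓
    Formula.iInf fun p : {p : Fin n × Fin n // p.1 ≠ p.2} =>
      ((Term.var (Sum.inr p.1.1)).equal (Term.var (Sum.inr p.1.2)) : L.Formula (α ⊕ Fin n)).not)

/-- The solutions of a formula in its last variable. -/
def solutions (φ : L.Formula (α ⊕ Unit)) (a : α → M) : Set M :=
  {x | φ.Realize (Sum.elim a fun _ => x)}

theorem realize_atLeast (φ : L.Formula (α ⊕ Unit)) (n : ℕ) (a : α → M) :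
    (atLeast φ n).Realize a ↔ (n : ℕ∞) ≤ (solutions φ a).encard := by
  have h1 : (atLeast φ n).Realize a ↔
      ∃ i : Fin n → M, (∀ k, i k ∈ solutions φ a) ∧ Function.Injective i := by
    simp only [atLeast, Formula.realize_iExs, Formula.realize_inf, Formula.realize_iInf,
      Formula.realize_relabel, Formula.realize_not, Formula.realize_equal, Term.realize_var,
      Sum.elim_inr, solutions, Set.mem_ofPred_eq]
    refine exists_congr fun i => and_congr (forall_congr' fun k => ?_) ?_
    · have : (Sum.elim a i ∘ Sum.elim Sum.inl fun _ : Unit => Sum.inr k) =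
          Sum.elim a fun _ => i k := by
        funext x; rcases x with x | x <;> rfl
      rw [this]
    · constructor
      · intro h x y hxy
        by_contra hne
        exact h ⟨(x, y), hne⟩ hxy
      · rintro h ⟨p, hp⟩ hxy
        exact hp (h hxy)
  rw [h1]
  constructor
  · rintro ⟨i, hi, hinj⟩
    have : Set.range i ⊆ solutions φ a := by rintro _ ⟨k, rfl⟩; exact hi k
    refine le_trans ?_ (Set.encard_le_encard this)
    rw [← Set.image_univ, hinj.encard_image]
    simp
  · intro h
    obtain ⟨t, ht, htn⟩ := Set.exists_subset_encard_eq h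
    have hf : t.Finite := Set.finite_of_encard_eq_coe htn
    have : hf.toFinset.card = n := by
      rw [hf.encard_eq_coe_toFinset_card] at htn
      exact_mod_cast htn
    let f := hf.toFinset.equivFinOfCardEq this
    exact ⟨fun k => (f.symm k).1, fun k => ht (hf.mem_toFinset.1 (f.symm k).2),
      Subtype.val_injective.comp f.symm.injective⟩

/-- Having at least `n` solutions is first order, so elementary maps preserve finiteness and the
exact size of finite solution sets. -/
theorem SameType.encard_solutions {a : α → M} {b : α → N} (h : SameType L a b)
    (φ : L.Formula (α ⊕ Unit)) : (solutions φ a).encard = (solutions φ b).encard := by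
  refine ENat.eq_of_forall_natCast_le_iff fun n => ?_
  rw [← realize_atLeast, ← realize_atLeast]
  exact h _

theorem SameType.finite_solutions {a : α → M} {b : α → N} (h : SameType L a b)
    {φ : L.Formula (α ⊕ Unit)} (hf : (solutions φ a).Finite) : (solutions φ b).Finite := by
  rw [← Set.encard_lt_top_iff] at hf ⊢
  rwa [← h.encard_solutions]

theorem SameType.nonempty_solutions {a : α → M} {b : α → N} (h : SameType L a b)
    {φ : L.Formula (α ⊕ Unit)} (hf : (solutions φ a).Nonempty) : (solutions φ b).Nonempty := by
  rw [← Set.encard_ne_zero] at hf ⊢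
  rwa [← h.encard_solutions]

variable (L) in
/-- `c` is algebraic over the family `a`. -/
def IsAlg (a : α → M) (c : M) : Prop :=
  ∃ φ : L.Formula (α ⊕ Unit), c ∈ solutions φ a ∧ (solutions φ a).Finite

theorem IsAlg.of_sameType {a : α → M} {b : α → N} {c : M} {d : N} (hc : IsAlg L a c)
    (h : SameType L (Sum.elim a fun _ : Unit => c) (Sum.elim b fun _ : Unit => d)) :
    IsAlg L b d := by
  obtain ⟨φ, hφ, hf⟩ := hc
  exact ⟨φ, (h φ).1 hφ, SameType.finite_solutions (h.comp Sum.inl) hf⟩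

theorem solutions_relabel (φ : L.Formula (β ⊕ Unit)) (f : β → α) (a : α → M) :
    solutions (φ.relabel (Sum.map f id)) a = solutions φ (a ∘ f) := by
  ext x
  simp only [solutions, Set.mem_ofPred_eq, Formula.realize_relabel, Sum.elim_comp_map,
    Function.comp_id]

theorem IsAlg.of_comp {a : α → M} {f : β → α} {c : M} (h : IsAlg L (a ∘ f) c) : IsAlg L a c := by
  obtain ⟨φ, hφ, hf⟩ := h
  refine ⟨φ.relabel (Sum.map f id), ?_, ?_⟩ <;> rwa [solutions_relabel]

theorem IsAlg.mono {a : α → M} {b : β → M} {c : M} (h : IsAlg L b c)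
    (hab : Set.range b ⊆ Set.range a) : IsAlg L a c := by
  choose f hf using fun i => hab ⟨i, rfl⟩
  have : a ∘ f = b := funext hf
  exact (this ▸ h : IsAlg L (a ∘ f) c).of_comp

theorem isAlg_self (a : α → M) (i : α) : IsAlg L a (a i) := by
  refine ⟨(Term.var (Sum.inr ())).equal (Term.var (Sum.inl i)), ?_, ?_⟩
  · simp [solutions, Formula.realize_equal]
  · simp [solutions, Formula.realize_equal]

theorem definable₁_iff_solutions {A S : Set M} :
    A.Definable₁ L S ↔ ∃ φ : L.Formula (A ⊕ Unit), S = solutions φ Subtype.val := by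
  rw [Set.Definable₁, Set.definable_iff_exists_formula_sum]
  constructor
  · rintro ⟨φ, hφ⟩
    refine ⟨φ.relabel (Sum.map id fun _ => ()), ?_⟩
    ext x
    have := Set.ext_iff.1 hφ (fun _ => x)
    simp only [Set.mem_ofPred_eq] at this
    rw [this, solutions, Set.mem_ofPred_eq, Formula.realize_relabel, Sum.elim_comp_map]
    rfl
  · rintro ⟨φ, rfl⟩
    refine ⟨φ.relabel (Sum.map id fun _ => 0), ?_⟩
    ext x
    simp only [solutions, Set.mem_ofPred_eq, Formula.realize_relabel, Sum.elim_comp_map]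
    rfl

theorem acl_range (a : α → M) : acl L (Set.range a) = {c | IsAlg L a c} := by
  ext c
  constructor
  · rintro ⟨S, hS, hfin, hc⟩
    obtain ⟨φ, rfl⟩ := definable₁_iff_solutions.1 hS
    exact IsAlg.mono (b := ((↑) : Set.range a → M)) ⟨φ, hc, hfin⟩
      Subtype.range_coe.subset
  · intro h
    obtain ⟨φ, hc, hfin⟩ := h.mono (a := ((↑) : Set.range a → M))
      Subtype.range_coe.superset
    exact ⟨_, definable₁_iff_solutions.2 ⟨φ, rfl⟩, hfin, hc⟩

/-- An algebraic element depends on finitely many elements. -/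
theorem IsAlg.exists_finset {a : α → M} {c : M} (h : IsAlg L a c) :
    ∃ s : Finset α, IsAlg L (fun i : s => a i) c := by
  obtain ⟨φ, hc, hf⟩ := h
  obtain ⟨s, ψ, hψ⟩ := exists_finset_support (φ.relabel Sum.swap)
  have : solutions (ψ.relabel Sum.swap) (fun i : s => a i) = solutions φ a := by
    ext x
    have h1 : Sum.elim (fun i : s => a i) (fun _ : Unit => x) ∘ Sum.swap =
        Sum.elim (fun _ => x) fun i : s => a i := by
      funext i; rcases i with i | i <;> rfl
    have h2 : Sum.elim (fun _ : Unit => x) a ∘ Sum.swap = Sum.elim a fun _ => x := by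
      funext i; rcases i with i | i <;> rfl
    simp only [solutions, Set.mem_ofPred_eq, Formula.realize_relabel, h1]
    rw [hψ M, Formula.realize_relabel, h2]
  exact ⟨s, ψ.relabel Sum.swap, this ▸ hc, this ▸ hf⟩

/-- A partial elementary map extends to any family of elements algebraic over its domain. -/
theorem SameType.exists_extend {a : α → M} {b : α → N} (h : SameType L a b) (c : γ → M)
    (hc : ∀ i, IsAlg L a (c i)) : ∃ d : γ → N, SameType L (Sum.elim a c) (Sum.elim b d) := by
  classical
  choose θ hθ hfin using hc
  -- Tychonoff: the candidate images form a product `K` of finite discrete sets. Each formula true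
  -- of `a`, `c` cuts out a closed condition, so finitely many conditions at a time suffice.
  let _ : TopologicalSpace N := ⊥
  have : DiscreteTopology N := ⟨rfl⟩
  let K : Set (γ → N) := Set.univ.pi fun i => solutions (θ i) b
  have hK : IsCompact K := isCompact_univ_pi fun i => (h.finite_solutions (hfin i)).isCompact
  let Z : {φ : L.Formula (α ⊕ γ) // φ.Realize (Sum.elim a c)} → Set (γ → N) := fun φ =>
    {d | φ.1.Realize (Sum.elim b d)}
  have hZ : ∀ φ, IsClosed (Z φ) := by
    intro φ
    obtain ⟨s, ψ, hψ⟩ := exists_finset_support φ.1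
    have : Z φ = (fun (d : γ → N) (i : s) => d i) ⁻¹'
        {d | ψ.Realize (Sum.elim b d)} := by
      ext d
      exact (hψ N b d).symm
    rw [this]
    exact (isClosed_discrete _).preimage (by fun_prop)
  have hne : ∀ t : Finset _, (K ∩ ⋂ φ ∈ t, Z φ).Nonempty := by
    intro t
    let Φ : L.Formula (α ⊕ γ) := Formula.iInf fun φ : t => φ.1.1
    have hΦ : Φ.Realize (Sum.elim a c) := by
      simp only [Φ, Formula.realize_iInf]
      exact fun φ => φ.1.2
    obtain ⟨s, ψ, hψ⟩ := exists_finset_support Φ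
    -- Including the algebraic formulas `θ i` forces the transferred witnesses to lie in `K`.
    let Ψ : L.Formula α := Formula.iExs s (ψ ⊓ Formula.iInf fun i : s =>
      (θ i).relabel (Sum.elim Sum.inl fun _ => Sum.inr i))
    have hel : ∀ (P : Type w) (a : α → P) (d : s → P) (i : s),
        (Sum.elim a d ∘ Sum.elim Sum.inl fun _ : Unit => Sum.inr i) =
          Sum.elim a fun _ => d i := by
      intro P a d i
      funext x; rcases x with x | x <;> rfl
    have hΨ : Ψ.Realize a := by
      simp only [Ψ, Formula.realize_iExs, Formula.realize_inf, Formula.realize_iInf,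
        Formula.realize_relabel, hel]
      exact ⟨fun i => c i, (hψ M a c).2 hΦ, fun i => hθ i⟩
    have hΨ' := (h Ψ).1 hΨ
    simp only [Ψ, Formula.realize_iExs, Formula.realize_inf, Formula.realize_iInf,
        Formula.realize_relabel, hel] at hΨ'
    obtain ⟨d, hd, hdθ⟩ := hΨ'
    -- Coordinates outside `s` do not affect `Φ`, but must still be filled with points of `K`.
    choose d' hd' using fun i => (h.nonempty_solutions ⟨_, hθ i⟩ : (solutions (θ i) b).Nonempty)
    let D : γ → N := fun i => if hi : i ∈ s then d ⟨i, hi⟩ else d' i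
    have hD : (fun i : s => D i) = d := by
      funext i
      simp [D]
    refine ⟨D, fun i _ => ?_, ?_⟩
    · by_cases hi : i ∈ s
      · simp only [D, hi, dif_pos]
        exact hdθ ⟨i, hi⟩
      · simp only [D, hi, dif_neg, not_false_eq_true]
        exact hd' i
    · have h3 : Φ.Realize (Sum.elim b D) := by
        rw [← hψ N b D, hD]
        exact hd
      simp only [Φ, Formula.realize_iInf] at h3
      simp only [Set.mem_iInter]
      exact fun φ hφ => h3 ⟨φ, hφ⟩
  obtain ⟨d, -, hd⟩ := hK.inter_iInter_nonempty Z hZ hne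
  refine ⟨d, SameType.of_imp fun φ hφ => ?_⟩
  exact Set.mem_iInter.1 hd ⟨φ, hφ⟩

end SameType

/-! ### Indiscernibility over the closure of a co-infinite part -/

section Indiscernible

variable {L : FirstOrder.Language.{u, v}} {M N : Type w} [L.Structure M] [L.Structure N]
  {ι ι' β : Type*}

theorem SameType.of_finset_comp {γ : Type*} {c : γ → M} {d : γ → N}
    (h : ∀ s : Finset γ, SameType L (fun i : s => c i) (fun i : s => d i)) : SameType L c d := by
  have : SameType L (Sum.elim (Empty.elim : Empty → M) c) (Sum.elim (Empty.elim : Empty → N) d) := by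
    refine SameType.of_finset fun s => ?_
    have := (h s).comp (Sum.elim Empty.elim id : Empty ⊕ s → s)
    convert this using 1 <;> · funext x; rcases x with x | x <;> [exact x.elim; rfl]
  exact this.comp Sum.inr

/-- The entries of the tuples of a family, along a reindexing. -/
def fam {κ : Type*} (e : ι → β → M) (f : κ → ι) : κ × β → M := fun p => e (f p.1) p.2

variable (L) in
/-- Any two `n`-tuples of distinct members of the two families have the same type. -/
def Similar (e : ι → β → M) (e' : ι' → β → N) : Prop :=
  ∀ (n : ℕ) (f : Fin n ↪ ι) (g : Fin n ↪ ι'), SameType L (fam e f) (fam e' g)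

theorem IsIndiscernible.similar {e : ι → β → M} (he : IsIndiscernible L e) : Similar L e e := he

theorem Similar.sameType {e : ι → β → M} {e' : ι' → β → N} (h : Similar L e e') {κ : Type*}
    (f : κ ↪ ι) (g : κ ↪ ι') : SameType L (fam e f) (fam e' g) := by
  classical
  refine SameType.of_finset_comp fun s => ?_
  let t := s.image Prod.fst
  have hs : ∀ p : s, p.1.1 ∈ t := fun p => Finset.mem_image_of_mem _ p.2
  let E := t.equivFin
  let i : Fin t.card ↪ κ := E.symm.toEmbedding.trans (Function.Embedding.subtype _)
  have := (h t.card (i.trans f) (i.trans g)).comp fun p : s => (E ⟨p.1.1, hs p⟩, p.1.2)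
  convert this using 1 <;> · funext p; simp [fam, i]

variable (L) in
/-- The algebraic closure of the members of a family with index in `J`. -/
def aclOn (e : ι → β → M) (J : Set ι) : Set M :=
  {c | IsAlg L (fam e ((↑) : J → ι)) c}

theorem aclOn_eq (e : ι → β → M) (J : Set ι) :
    aclOn L e J = acl L (entries fun j : J => e j) := by
  have : entries (fun j : J => e j) = Set.range (fam e ((↑) : J → ι)) := by
    ext x
    simp [entries, fam]
  rw [this, acl_range]
  rfl

theorem aclOn_range {κ : Type*} (e : ι → β → M) (f : κ → ι) :
    aclOn L e (Set.range f) = {c | IsAlg L (fam e f) c} := by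
  have : Set.range (fam e ((↑) : Set.range f → ι)) = Set.range (fam e f) := by
    ext x
    simp [fam]
  ext c
  exact ⟨fun h => IsAlg.mono h this.subset, fun h => IsAlg.mono h this.superset⟩

theorem aclOn_mono (e : ι → β → M) {J K : Set ι} (h : J ⊆ K) : aclOn L e J ⊆ aclOn L e K :=
  fun _ hc => IsAlg.of_comp (f := fun p : J × β => ((⟨p.1, h p.1.2⟩ : K), p.2)) hc

theorem entry_mem_aclOn (e : ι → β → M) {J : Set ι} {j : ι} (hj : j ∈ J) (b : β) :
    e j b ∈ aclOn L e J :=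
  isAlg_self (fam e ((↑) : J → ι)) (⟨j, hj⟩, b)

theorem exists_finset_aclOn {e : ι → β → M} {J : Set ι} {c : M} (hc : c ∈ aclOn L e J) :
    ∃ G : Finset ι, (G : Set ι) ⊆ J ∧ c ∈ aclOn L e G := by
  classical
  obtain ⟨s, hs⟩ := IsAlg.exists_finset hc
  refine ⟨s.image fun p => p.1.1, ?_, hs.mono ?_⟩
  · intro x hx
    simp only [Finset.coe_image, Set.mem_image] at hx
    obtain ⟨p, -, rfl⟩ := hx
    exact p.1.2
  · rintro _ ⟨p, rfl⟩
    exact ⟨(⟨p.1.1, Finset.mem_coe.2 (Finset.mem_image_of_mem _ p.2)⟩, p.1.2), rfl⟩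

theorem exists_finset_aclOn_finite {e : ι → β → M} {J : Set ι} {A : Set M} (hA : A.Finite)
    (hc : A ⊆ aclOn L e J) : ∃ G : Finset ι, (G : Set ι) ⊆ J ∧ A ⊆ aclOn L e G := by
  classical
  have : ∀ c : A, ∃ G : Finset ι, (G : Set ι) ⊆ J ∧ c.1 ∈ aclOn L e G :=
    fun c => exists_finset_aclOn (hc c.2)
  choose G hGJ hG using this
  have := hA.fintype
  refine ⟨Finset.univ.biUnion G, by simpa using hGJ, fun c hcA => ?_⟩
  refine aclOn_mono e ?_ (hG ⟨c, hcA⟩)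
  exact_mod_cast Finset.subset_biUnion_of_mem G (Finset.mem_univ _)

theorem exists_embedding_of_infinite {J : Set ι} (hJ : J.Infinite) (F : Type*) [Countable F] :
    ∃ h : F ↪ ι, ∀ i, h i ∈ J := by
  have := hJ.to_subtype
  obtain ⟨f⟩ := nonempty_embedding_nat F
  exact ⟨(f.trans (Infinite.natEmbedding J)).trans (Function.Embedding.subtype _),
    fun i => Subtype.property _⟩

theorem sumElim_injective_of_disjoint {J : Set ι} {F G : Type*} (f : F ↪ ι) (g : G ↪ ι)
    (hf : ∀ i, f i ∉ J) (hg : ∀ i, g i ∉ J) (hfg : ∀ i j, f i ≠ g j) :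
    Function.Injective (Sum.elim ((↑) : J → ι) (Sum.elim f g)) := by
  refine Subtype.val_injective.sumElim (f.injective.sumElim g.injective hfg) ?_
  rintro a (b | b) h
  · exact hf b ((show a.1 = f b from h) ▸ a.2)
  · exact hg b ((show a.1 = g b from h) ▸ a.2)

/-- The tuple `a` lies in a finite set `S` definable over `J`, so agreement of two blocks on all of
`S` is a property of the indiscernibles alone, and total indiscernibility transfers it from one pair
of disjoint blocks to every other. -/
theorem sameType_over_finite_of_disjoint {e : ι → β → M} (he : IsIndiscernible L e) {J : Set ι}
    (hJ : Jᶜ.Infinite) {F : Type*} [Finite F] (f g : F ↪ ι) (hf : ∀ i, f i ∉ J)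
    (hg : ∀ i, g i ∉ J) (hfg : ∀ i j, f i ≠ g j) {s : Type*} [Finite s] (a : s → M)
    (ha : ∀ i, a i ∈ aclOn L e J) :
    SameType L (Sum.elim a (fam e f)) (Sum.elim a (fam e g)) := by
  classical
  intro ψ
  choose θ hθ hfin using ha
  let S : Set (s → M) := Set.univ.pi fun i => solutions (θ i) (fam e ((↑) : J → ι))
  have hS : S.Finite := Set.Finite.pi fun i => hfin i
  obtain ⟨h, hh⟩ := exists_embedding_of_infinite hJ (ℕ × F)
  let h' : ℕ → F ↪ ι := fun n => ⟨fun i => h (n, i), fun i j hij => by simpa using hij⟩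
  let P : (F ↪ ι) → Set (s → M) := fun f => {x ∈ S | ψ.Realize (Sum.elim x (fam e f))}
  -- Pigeonhole: infinitely many blocks, but `S` has only finitely many subsets.
  obtain ⟨m, n, hmn, hP⟩ : ∃ m n, m ≠ n ∧ P (h' m) = P (h' n) := by
    have := hS.finite_subsets.to_subtype
    obtain ⟨m, n, hmn, hP⟩ := Finite.exists_ne_map_eq_of_infinite
      (fun n => (⟨P (h' n), fun _ hx => hx.1⟩ : {t : Set (s → M) | t ⊆ S}))
    exact ⟨m, n, hmn, congrArg Subtype.val hP⟩
  let Q : L.Formula ((J ⊕ (F ⊕ F)) × β) := Formula.iAlls s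
    ((Formula.iInf fun i => (θ i).relabel
        (Sum.elim (fun p => Sum.inl (Sum.inl p.1, p.2)) fun _ => Sum.inr i)).imp
      ((ψ.relabel (Sum.elim Sum.inr fun p => Sum.inl (Sum.inr (Sum.inl p.1), p.2))).iff
        (ψ.relabel (Sum.elim Sum.inr fun p => Sum.inl (Sum.inr (Sum.inr p.1), p.2)))))
  have hQ : ∀ f g : F ↪ ι, Q.Realize (fam e (Sum.elim ((↑) : J → ι) (Sum.elim f g))) ↔
      ∀ x ∈ S, (ψ.Realize (Sum.elim x (fam e f)) ↔ ψ.Realize (Sum.elim x (fam e g))) := by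
    intro f g
    simp only [Q, Formula.realize_iAlls, Formula.realize_imp, Formula.realize_iInf,
      Formula.realize_iff, Formula.realize_relabel]
    refine forall_congr' fun x => ?_
    have h1 : ∀ i, (Sum.elim (fam e (Sum.elim ((↑) : J → ι) (Sum.elim f g))) x ∘
        Sum.elim (fun p => Sum.inl (Sum.inl p.1, p.2)) fun _ : Unit => Sum.inr i) =
        Sum.elim (fam e ((↑) : J → ι)) fun _ => x i := by
      intro i; funext p; rcases p with p | p <;> rfl
    have h2 : (Sum.elim (fam e (Sum.elim ((↑) : J → ι) (Sum.elim f g))) x ∘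
        Sum.elim Sum.inr fun p : F × β => Sum.inl (Sum.inr (Sum.inl p.1), p.2)) =
        Sum.elim x (fam e f) := by
      funext p; rcases p with p | p <;> rfl
    have h3 : (Sum.elim (fam e (Sum.elim ((↑) : J → ι) (Sum.elim f g))) x ∘
        Sum.elim Sum.inr fun p : F × β => Sum.inl (Sum.inr (Sum.inr p.1), p.2)) =
        Sum.elim x (fam e g) := by
      funext p; rcases p with p | p <;> rfl
    simp only [h1, h2, h3, S, Set.mem_univ_pi]
    rfl
  have hQh : Q.Realize (fam e (Sum.elim ((↑) : J → ι) (Sum.elim (h' m) (h' n)))) := by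
    rw [hQ]
    intro x hx
    have := Set.ext_iff.1 hP x
    simpa [P, hx] using this
  have hsame := he.similar.sameType
    ⟨_, sumElim_injective_of_disjoint (h' m) (h' n) (fun i => hh (m, i)) (fun i => hh (n, i))
      (fun i j hij => hmn (by simpa using congrArg Prod.fst (h.injective hij)))⟩
    ⟨_, sumElim_injective_of_disjoint f g hf hg hfg⟩
  exact (hQ f g).1 ((hsame Q).1 hQh) a fun i _ => hθ i

theorem sameType_over_finite {e : ι → β → M} (he : IsIndiscernible L e) {J : Set ι}
    (hJ : Jᶜ.Infinite) {F : Type*} [Finite F] (f g : F ↪ ι) (hf : ∀ i, f i ∉ J)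
    (hg : ∀ i, g i ∉ J) {s : Type*} [Finite s] (a : s → M)
    (ha : ∀ i, a i ∈ aclOn L e J) :
    SameType L (Sum.elim a (fam e f)) (Sum.elim a (fam e g)) := by
  have hinf : (Jᶜ \ (Set.range f ∪ Set.range g)).Infinite :=
    hJ.sdiff ((Set.finite_range f).union (Set.finite_range g))
  -- A third block disjoint from both reduces overlapping blocks to disjoint ones.
  obtain ⟨h, hh⟩ := exists_embedding_of_infinite hinf F
  refine (sameType_over_finite_of_disjoint he hJ f h hf (fun i => (hh i).1) ?_ a ha).trans
    (sameType_over_finite_of_disjoint he hJ h g (fun i => (hh i).1) hg ?_ a ha)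
  · intro i j hij
    exact (hh j).2 (Or.inl ⟨i, hij⟩)
  · intro i j hij
    exact (hh i).2 (Or.inr ⟨j, hij.symm⟩)

/-- An indiscernible set remains indiscernible over the algebraic closure of a co-infinite
subset. -/
theorem sameType_over_aclOn {e : ι → β → M} (he : IsIndiscernible L e) {J : Set ι}
    (hJ : Jᶜ.Infinite) {F : Type*} (f g : F ↪ ι) (hf : ∀ i, f i ∉ J) (hg : ∀ i, g i ∉ J) :
    SameType L (Sum.elim ((↑) : aclOn L e J → M) (fam e f))
      (Sum.elim ((↑) : aclOn L e J → M) (fam e g)) := by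
  classical
  refine SameType.of_finset_comp fun s => ?_
  let t := s.toRight.image Prod.fst
  let i := Function.Embedding.subtype (· ∈ t)
  have := sameType_over_finite he hJ (i.trans f) (i.trans g) (fun j => hf _) (fun j => hg _)
    (fun j : s.toLeft => j.1.1) fun j => j.1.2
  have := this.comp (fun p : s => (Sum.casesOn p.1
    (fun x hx => Sum.inl ⟨x, by simpa using hx⟩)
    (fun x hx => Sum.inr (⟨x.1, Finset.mem_image_of_mem _ (by simpa using hx)⟩, x.2)) p.2 :
      s.toLeft ⊕ (t × β)))
  convert this using 1 <;> · funext ⟨p, hp⟩; rcases p with p | p <;> rfl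

variable (L) in
/-- `c` and `d` have the same type over the set `A`. -/
def SameOver (A : Set M) (c d : M) : Prop :=
  SameType L (Sum.elim ((↑) : A → M) fun _ : Unit => c) (Sum.elim ((↑) : A → M) fun _ : Unit => d)

theorem SameOver.mono {A B : Set M} (hAB : A ⊆ B) {c d : M} (h : SameOver L B c d) :
    SameOver L A c d := by
  have := SameType.comp h (Sum.map (Set.inclusion hAB) id)
  rwa [Sum.elim_comp_map, Sum.elim_comp_map] at this

/-- Every type over `aclOn e J` realized in `aclOn e univ` is realized in `aclOn e (J ∪ C)` for
any finite set `C` outside of `J` that is large enough. -/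
theorem exists_sameOver_aclOn {e : ι → β → M} (he : IsIndiscernible L e) {J X : Set ι}
    (hX : X.Infinite) (hXJ : Disjoint X J) {c : M} (hc : c ∈ aclOn L e Set.univ) :
    ∃ (c' : M) (C : Finset ι), (C : Set ι) ⊆ X ∧ c' ∈ aclOn L e (J ∪ C) ∧
      SameOver L (aclOn L e J) c c' := by
  classical
  obtain ⟨G, -, hG⟩ := exists_finset_aclOn hc
  have hJ : Jᶜ.Infinite := hX.mono hXJ.subset_compl_right
  -- The part of the support of `c` outside `J` is moved into `X` over `aclOn L e J`, and `c` is
  -- carried along.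
  let D := {i // i ∈ G ∧ i ∉ J}
  have hD : Finite D := (G.finite_toSet.subset fun i hi => hi.1 : {i | i ∈ G ∧ i ∉ J}.Finite)
  let f : D ↪ ι := Function.Embedding.subtype _
  obtain ⟨g, hg⟩ := exists_embedding_of_infinite hX D
  have hgJ : ∀ i, g i ∉ J := fun i => Set.disjoint_left.1 hXJ (hg i)
  have hsame := sameType_over_aclOn he hJ f g (fun i => i.2.2) hgJ
  let R : (J ⊕ D) × β → aclOn L e J ⊕ (D × β) := fun p => Sum.elim
    (fun j : J => Sum.inl ⟨e j p.2, entry_mem_aclOn e j.2 p.2⟩) (fun d => Sum.inr (d, p.2)) p.1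
  have hR : ∀ g : D ↪ ι, Sum.elim ((↑) : aclOn L e J → M) (fam e g) ∘ R =
      fam e (Sum.elim ((↑) : J → ι) g) := by
    intro g; funext ⟨p, b⟩; rcases p with p | p <;> rfl
  have halg : IsAlg L (fam e (Sum.elim ((↑) : J → ι) f)) c := by
    refine IsAlg.mono hG ?_
    rintro _ ⟨⟨i, b⟩, rfl⟩
    by_cases h : i.1 ∈ J
    · exact ⟨(Sum.inl ⟨i, h⟩, b), rfl⟩
    · exact ⟨(Sum.inr ⟨i, i.2, h⟩, b), rfl⟩
  obtain ⟨d, hd⟩ := hsame.exists_extend (fun _ : Unit => c) fun _ => IsAlg.of_comp (f := R) (by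
    rw [hR]; exact halg)
  have hgfin : (Set.range g).Finite := Set.finite_range g
  refine ⟨d (), hgfin.toFinset, ?_, ?_, ?_⟩
  · rw [hgfin.coe_toFinset]
    rintro _ ⟨i, rfl⟩
    exact hg i
  · have h1 : IsAlg L (fam e (Sum.elim ((↑) : J → ι) g)) (d ()) := by
      refine halg.of_sameType ?_
      have := hd.comp (Sum.map R id)
      rwa [Sum.elim_comp_map, Sum.elim_comp_map, hR, hR] at this
    have h2 : J ∪ hgfin.toFinset = Set.range (Sum.elim ((↑) : J → ι) g) := by
      simp
    rw [h2, aclOn_range]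
    exact h1
  · have := hd.comp (Sum.map Sum.inl id)
    rwa [Sum.elim_comp_map, Sum.elim_comp_map] at this

end Indiscernible

/-! ### Saturation in terms of ultrafilters -/

section Saturation

variable {L : FirstOrder.Language.{u, v}} {M N : Type w} [L.Structure M] [L.Structure N]

/-- A formula with parameters uses only finitely many of them. -/
theorem exists_finite_parameters {A : Set M} (φ : L.Formula (A ⊕ Unit)) :
    ∃ B ⊆ A, B.Finite ∧ ∃ ψ : L.Formula (B ⊕ Unit),
      solutions ψ Subtype.val = solutions φ Subtype.val := by
  obtain ⟨B, hBA, hB⟩ := Set.definable_iff_finitely_definable.1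
    (definable₁_iff_solutions.2 ⟨φ, rfl⟩ : A.Definable₁ L (solutions φ Subtype.val))
  obtain ⟨ψ, hψ⟩ := definable₁_iff_solutions.1 hB
  exact ⟨B, hBA, B.finite_toSet, ψ, hψ.symm⟩

theorem SameOver.of_finite {A : Set M} {c d : M}
    (h : ∀ B ⊆ A, B.Finite → SameOver L B c d) : SameOver L A c d := fun φ => by
  obtain ⟨B, hBA, hB, ψ, hψ⟩ := exists_finite_parameters φ
  have := h B hBA hB ψ
  change c ∈ solutions ψ _ ↔ d ∈ solutions ψ _ at this
  rwa [hψ] at this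

/-- The Tarski–Vaught test, with finitely many parameters from the set. -/
theorem exists_elementarySubstructure (S : Set M)
    (h : ∀ A ⊆ S, A.Finite → ∀ φ : L.Formula (A ⊕ Unit), (solutions φ Subtype.val).Nonempty →
      (solutions φ Subtype.val ∩ S).Nonempty) :
    ∃ N : L.ElementarySubstructure M, (N : Set M) = S := by
  have hS : L.MeetsDefinable S := by
    intro D hD hdef
    obtain ⟨φ, rfl⟩ := definable₁_iff_solutions.1 hdef
    obtain ⟨B, hBA, hB, ψ, hψ⟩ := exists_finite_parameters φ
    rw [← hψ] at hD ⊢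
    exact h B hBA hB ψ hD
  exact ⟨hS.toElementarySubstructure, hS.closure_eq_self⟩

variable (L) in
/-- `c` realizes the restriction to `A` of the type over `M` given by the ultrafilter `U`. -/
def RealizesOn (U : Ultrafilter M) (A : Set M) (c : M) : Prop :=
  ∀ φ : L.Formula (A ⊕ Unit), solutions φ Subtype.val ∈ U → c ∈ solutions φ Subtype.val

theorem compl_solutions {α : Type*} (φ : L.Formula (α ⊕ Unit)) (a : α → M) :
    solutions φ.not a = (solutions φ a)ᶜ := rfl

theorem RealizesOn.iff {U : Ultrafilter M} {A : Set M} {c : M} (h : RealizesOn L U A c)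
    (φ : L.Formula (A ⊕ Unit)) : c ∈ solutions φ Subtype.val ↔ solutions φ Subtype.val ∈ U := by
  refine ⟨fun hc => ?_, h φ⟩
  by_contra hU
  rw [← Ultrafilter.compl_mem_iff_notMem, ← compl_solutions] at hU
  exact h _ hU hc

theorem RealizesOn.sameOver {U : Ultrafilter M} {A : Set M} {c d : M} (hc : RealizesOn L U A c)
    (hd : RealizesOn L U A d) : SameOver L A c d := fun φ => (hc.iff φ).trans (hd.iff φ).symm

theorem RealizesOn.of_sameOver {U : Ultrafilter M} {A : Set M} {c d : M}
    (hc : RealizesOn L U A c) (h : SameOver L A c d) : RealizesOn L U A d :=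
  fun φ hφ => (h φ).1 (hc φ hφ)

theorem RealizesOn.mono {U : Ultrafilter M} {A B : Set M} (hAB : A ⊆ B) {c : M}
    (hc : RealizesOn L U B c) : RealizesOn L U A c := fun φ hφ => by
  have := hc (φ.relabel (Sum.map (Set.inclusion hAB) id))
  rw [solutions_relabel] at this
  exact this hφ

theorem RealizesOn.of_finite {U : Ultrafilter M} {A : Set M} {c : M}
    (h : ∀ B ⊆ A, B.Finite → RealizesOn L U B c) : RealizesOn L U A c := fun φ => by
  obtain ⟨B, hBA, hB, ψ, hψ⟩ := exists_finite_parameters φ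
  rw [← hψ]
  exact h B hBA hB ψ

theorem exists_formula_withConstants {A : Set M} (φ : L.Formula (A ⊕ Unit)) :
    ∃ ψ : L[[A]].Formula (Fin 1), ∀ a : Fin 1 → M,
      ψ.Realize a ↔ a 0 ∈ solutions φ Subtype.val := by
  obtain ⟨ψ, hψ⟩ := definable₁_iff_solutions.2 ⟨φ, rfl⟩
  exact ⟨ψ, fun a => (Set.ext_iff.1 hψ a).symm⟩

theorem exists_formula_of_withConstants {A : Set M} (ψ : L[[A]].Formula (Fin 1)) :
    ∃ φ : L.Formula (A ⊕ Unit), ∀ c : M,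
      ψ.Realize (fun _ => c) ↔ c ∈ solutions φ Subtype.val := by
  obtain ⟨φ, hφ⟩ := definable₁_iff_solutions.1
    (⟨ψ, by
      ext a
      have : (fun _ => a 0) = a := by funext i; rw [Subsingleton.elim i 0]
      simp only [Set.mem_ofPred_eq, this]⟩ :
        A.Definable₁ L {c | ψ.Realize fun _ : Fin 1 => c})
  exact ⟨φ, fun c => Set.ext_iff.1 hφ c⟩

theorem IsSaturated.exists_realization (hM : IsSaturated L M) {A : Set M} (hA : #A < #M)
    (p : Set (L.Formula (A ⊕ Unit)))
    (hp : ∀ q : Finset (L.Formula (A ⊕ Unit)), (q : Set _) ⊆ p →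
      ∃ c : M, ∀ φ ∈ q, c ∈ solutions φ Subtype.val) :
    ∃ c : M, ∀ φ ∈ p, c ∈ solutions φ Subtype.val := by
  classical
  choose F hF using fun φ : L.Formula (A ⊕ Unit) => exists_formula_withConstants φ
  obtain ⟨a, ha⟩ := hM A hA (F '' p) (by
    intro q hq
    obtain ⟨q', hq', rfl⟩ := Finset.subset_set_image_iff.1 hq
    obtain ⟨c, hc⟩ := hp q' hq'
    refine ⟨fun _ => c, fun ψ hψ => ?_⟩
    obtain ⟨φ, hφ, rfl⟩ := Finset.mem_image.1 hψ
    exact (hF φ _).2 (hc φ hφ))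
  exact ⟨a 0, fun φ hφ => (hF φ a).1 (ha _ ⟨φ, hφ, rfl⟩)⟩

theorem IsSaturated.exists_realizesOn (hM : IsSaturated L M) {A : Set M} (hA : #A < #M)
    (U : Ultrafilter M) : ∃ c, RealizesOn L U A c := by
  refine hM.exists_realization hA {φ | solutions φ Subtype.val ∈ U} fun q hq => ?_
  have : (⋂ φ ∈ q, solutions φ (Subtype.val : A → M)) ∈ U := by
    have := (Filter.biInter_finset_mem (f := (U : Filter M)) (s := fun φ => solutions φ
      (Subtype.val : A → M)) q).2 fun φ hφ => hq hφ
    exact this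
  obtain ⟨c, hc⟩ := U.nonempty_of_mem this
  exact ⟨c, by simpa using hc⟩

/-- The solution sets of a finitely satisfiable type have the finite intersection property, so they
extend to an ultrafilter. Ultrafilters on the model thus stand in for types. -/
theorem isSaturated_of_realizesOn
    (h : ∀ A : Set M, #A < #M → ∀ U : Ultrafilter M, ∃ c, RealizesOn L U A c) :
    IsSaturated L M := by
  classical
  intro A hA p hp
  choose F hF using fun φ : L[[A]].Formula (Fin 1) => exists_formula_of_withConstants φ
  obtain ⟨U, hU⟩ := Ultrafilter.exists_ultrafilter_of_finite_inter_nonempty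
    ((fun φ => solutions (F φ) Subtype.val) '' p) (by
      intro q hq
      obtain ⟨q', hq', rfl⟩ := Finset.subset_set_image_iff.1 hq
      obtain ⟨a, ha⟩ := hp q' hq'
      refine ⟨a 0, ?_⟩
      rintro s hs
      obtain ⟨φ, hφ, rfl⟩ := Finset.mem_image.1 (Finset.mem_coe.1 hs)
      refine (hF φ _).1 ?_
      have : (fun _ => a 0) = a := by funext i; rw [Subsingleton.elim i 0]
      rw [this]
      exact ha φ hφ)
  obtain ⟨c, hc⟩ := h A hA U
  exact ⟨fun _ => c, fun φ hφ => (hF φ c).2 (hc _ (hU ⟨φ, hφ, rfl⟩))⟩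

end Saturation

/-! ### Closures of parts of the indiscernible set -/

section Closure

variable {L : FirstOrder.Language.{u, v}} {M : Type w} [L.Structure M] {ι : Type w} {β : Type*}
  {e : ι → β → M}

theorem exists_elementarySubstructure_aclOn (he : IsIndiscernible L e)
    (hM : aclOn L e Set.univ = Set.univ) {J : Set ι} (hJ : J.Infinite) :
    ∃ N : L.ElementarySubstructure M, (N : Set M) = aclOn L e J := by
  refine exists_elementarySubstructure _ fun A hAJ hA φ ⟨c, hc⟩ => ?_
  obtain ⟨G, hGJ, hG⟩ := exists_finset_aclOn_finite hA hAJ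
  obtain ⟨c', C, hCJ, hc', hcc'⟩ := exists_sameOver_aclOn he (hJ.sdiff G.finite_toSet)
    Set.disjoint_sdiff_left (c := c) (hM ▸ Set.mem_univ c)
  exact ⟨c', (hcc'.mono hG φ).1 hc, aclOn_mono e
    (Set.union_subset hGJ (hCJ.trans Set.sdiff_subset)) hc'⟩

/-- Each element has a finite support. For infinite `A` the union of the supports has size at most
`|A|`; for finite `A` it is finite, hence smaller than `J`. -/
theorem exists_small_index {J : Set ι} (hJ : J.Infinite) {A : Set M} (hAJ : A ⊆ aclOn L e J)
    (hA : #A < #J) : ∃ J₀ ⊆ J, #J₀ < #J ∧ A ⊆ aclOn L e J₀ := by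
  have hJ' := Set.infinite_coe_iff.2 hJ
  by_cases hfin : A.Finite
  · obtain ⟨G, hGJ, hG⟩ := exists_finset_aclOn_finite hfin hAJ
    exact ⟨G, hGJ, (Cardinal.lt_aleph0_of_finite G).trans_le (Cardinal.aleph0_le_mk J), hG⟩
  · choose G hGJ hG using fun a : A => exists_finset_aclOn (hAJ a.2)
    refine ⟨⋃ a, (G a : Set ι), Set.iUnion_subset hGJ, ?_, fun a ha =>
      aclOn_mono e (Set.subset_iUnion (fun a => (G a : Set ι)) ⟨a, ha⟩) (hG ⟨a, ha⟩)⟩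
    have hA' : Infinite A := Set.infinite_coe_iff.2 hfin
    refine lt_of_le_of_lt ?_ hA
    refine (Cardinal.mk_iUnion_le_sum_mk).trans ?_
    refine (Cardinal.sum_le_sum _ (fun _ => ℵ₀) fun a =>
      (Cardinal.lt_aleph0_of_finite (G a)).le).trans ?_
    rw [Cardinal.sum_const']
    exact (Cardinal.mul_aleph0_eq (Cardinal.aleph0_le_mk A)).le

theorem infinite_sdiff_of_mk_lt {J J₀ : Set ι} (hJ : J.Infinite) (h : #J₀ < #J) :
    (J \ J₀).Infinite := by
  have hJ' := Set.infinite_coe_iff.2 hJ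
  by_contra hfin
  rw [Set.not_infinite] at hfin
  have h1 : J ⊆ J₀ ∪ (J \ J₀) := by simp
  have h2 : #J ≤ #J₀ + #(J \ J₀ : Set ι) := (Cardinal.mk_le_mk_of_subset h1).trans
    (Cardinal.mk_union_le _ _)
  exact h2.not_gt (Cardinal.add_lt_of_lt (Cardinal.aleph0_le_mk J) h
    ((Cardinal.lt_aleph0_iff_set_finite.2 hfin).trans_le (Cardinal.aleph0_le_mk J)))

/-- The algebraic closure of an infinite part of an indiscernible set is saturated, if
the types over the closures of smaller parts are realized in the whole model. -/
theorem isSaturated_of_coe_eq_aclOn (he : IsIndiscernible L e)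
    (hM : aclOn L e Set.univ = Set.univ) {J : Set ι} (hJ : J.Infinite)
    (N : L.ElementarySubstructure M) (hN : (N : Set M) = aclOn L e J) (hcard : #N = #J)
    (hreal : ∀ J₀ ⊆ J, #J₀ < #J → ∀ U : Ultrafilter M, ∃ c, RealizesOn L U (aclOn L e J₀) c) :
    IsSaturated L N := by
  refine isSaturated_of_realizesOn fun A hA U => ?_
  have hA' : #((↑) '' A : Set M) < #J := by
    rw [Cardinal.mk_image_eq Subtype.val_injective, ← hcard]
    exact hA
  obtain ⟨J₀, hJ₀, hJ₀J, hAJ₀⟩ := exists_small_index hJ (A := ((↑) '' A : Set M)) (by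
    rintro _ ⟨a, -, rfl⟩
    rw [← hN]
    exact a.2) hA'
  -- The type is realized in `M` first; the realization is then moved over `aclOn L e J₀` to one
  -- supported in `J`.
  obtain ⟨c, hc⟩ := hreal J₀ hJ₀ hJ₀J (U.map (↑))
  obtain ⟨c', C, hCJ, hc', hcc'⟩ := exists_sameOver_aclOn he (infinite_sdiff_of_mk_lt hJ hJ₀J)
    Set.disjoint_sdiff_left (c := c) (hM ▸ Set.mem_univ c)
  have hc'N : c' ∈ N := by
    rw [← SetLike.mem_coe, hN]
    exact aclOn_mono e (Set.union_subset hJ₀ (hCJ.trans Set.sdiff_subset)) hc'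
  have hreal' := hc.of_sameOver hcc'
  refine ⟨⟨c', hc'N⟩, fun φ hφ => ?_⟩
  let r : A → aclOn L e J₀ := fun a => ⟨a.1.1, hAJ₀ ⟨a.1, a.2, rfl⟩⟩
  have key : ∀ n : N, n ∈ solutions φ (Subtype.val : A → N) ↔
      (n : M) ∈ solutions (φ.relabel (Sum.map r id)) (Subtype.val : aclOn L e J₀ → M) := by
    intro n
    rw [solutions_relabel]
    have := sameType_embedding N.subtype
      (Sum.elim (Subtype.val : A → N) fun _ : Unit => n) φ
    rw [Sum.comp_elim] at this
    exact this
  rw [key]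
  refine hreal' _ ?_
  rw [Ultrafilter.mem_map]
  convert hφ using 1
  ext n
  exact (key n).symm

/-- Two elements independent from `J'` over `J` with the same type over the closure of `J` have
the same type over the closure of `J'`. -/
theorem SameOver.extend (he : IsIndiscernible L e) {J J' : Set ι} (hJ : J.Infinite)
    {C₁ C₂ : Finset ι} (h₁ : ∀ i ∈ C₁, i ∉ J') (h₂ : ∀ i ∈ C₂, i ∉ J') {c₁ c₂ : M}
    (hc₁ : c₁ ∈ aclOn L e (J ∪ C₁)) (hc₂ : c₂ ∈ aclOn L e (J ∪ C₂))
    (h : SameOver L (aclOn L e J) c₁ c₂) : SameOver L (aclOn L e J') c₁ c₂ := by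
  classical
  refine SameOver.of_finite fun B hBJ' hB => ?_
  obtain ⟨G, hGJ', hG⟩ := exists_finset_aclOn_finite hB hBJ'
  obtain ⟨G₁, hG₁J, hG₁⟩ := exists_finset_aclOn hc₁
  obtain ⟨G₂, hG₂J, hG₂⟩ := exists_finset_aclOn hc₂
  -- `K` supports both `c₁` and `c₂`, and meets the support `G` of `B` only inside `J`. Moving `G \
  -- K` into `J` over `aclOn L e K` sends `B` to `d` in `aclOn L e J` and fixes `c₁` and `c₂`; over
  -- `d` the two have the same type by hypothesis.
  let K : Set ι := G₁ ∪ G₂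
  have hK : K.Finite := G₁.finite_toSet.union G₂.finite_toSet
  have hKc : Kᶜ.Infinite := (hJ.sdiff hK).mono fun i hi => hi.2
  have hH : ∀ i ∈ G, i ∈ K → i ∈ J := by
    rintro i hi (hiK | hiK)
    · rcases hG₁J hiK with h | h
      exacts [h, (h₁ i h (hGJ' hi)).elim]
    · rcases hG₂J hiK with h | h
      exacts [h, (h₂ i h (hGJ' hi)).elim]
  let D := {i // i ∈ G ∧ i ∉ K}
  let H := {i // i ∈ G ∧ i ∈ K}
  have hD : Finite D := (G.finite_toSet.subset fun i hi => hi.1 : {i | i ∈ G ∧ i ∉ K}.Finite)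
  let f : D ↪ ι := Function.Embedding.subtype _
  obtain ⟨g, hg⟩ := exists_embedding_of_infinite (hJ.sdiff hK) D
  have hsame := sameType_over_aclOn he hKc f g (fun i => i.2.2) fun i => (hg i).2
  let R : (H ⊕ D) × β → aclOn L e K ⊕ (D × β) := fun p => Sum.elim
    (fun j : H => Sum.inl ⟨e j.1 p.2, entry_mem_aclOn e j.2.2 p.2⟩) (fun d => Sum.inr (d, p.2)) p.1
  have hR : ∀ g : D ↪ ι, Sum.elim ((↑) : aclOn L e K → M) (fam e g) ∘ R =
      fam e (Sum.elim ((↑) : H → ι) g) := by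
    intro g; funext ⟨p, b⟩; rcases p with p | p <;> rfl
  have halg : ∀ b : B, IsAlg L (fam e (Sum.elim ((↑) : H → ι) f)) b := by
    intro b
    refine IsAlg.mono (hG b.2) ?_
    rintro _ ⟨⟨i, b⟩, rfl⟩
    by_cases h : i.1 ∈ K
    · exact ⟨(Sum.inl ⟨i, i.2, h⟩, b), rfl⟩
    · exact ⟨(Sum.inr ⟨i, i.2, h⟩, b), rfl⟩
  obtain ⟨d, hd⟩ := hsame.exists_extend ((↑) : B → M) fun b => IsAlg.of_comp (f := R) (by
    rw [hR]; exact halg b)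
  have hdJ : ∀ b, d b ∈ aclOn L e J := by
    intro b
    have h1 : IsAlg L (fam e (Sum.elim ((↑) : H → ι) g)) (d b) := by
      refine (halg b).of_sameType ?_
      have := hd.comp (Sum.map R fun _ : Unit => b)
      rwa [Sum.elim_comp_map, Sum.elim_comp_map, hR, hR] at this
    have h2 : d b ∈ aclOn L e (Set.range (Sum.elim ((↑) : H → ι) g)) := by
      rw [aclOn_range]
      exact h1
    refine aclOn_mono e ?_ h2
    rintro _ ⟨i | i, rfl⟩
    · exact hH i.1 i.2.1 i.2.2
    · exact (hg i).1
  have hmove : ∀ c ∈ aclOn L e K, SameType L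
      (Sum.elim ((↑) : B → M) fun _ : Unit => c) (Sum.elim d fun _ : Unit => c) := by
    intro c hc
    have := hd.comp (Sum.elim Sum.inr fun _ : Unit => Sum.inl (Sum.inl ⟨c, hc⟩))
    rwa [Sum.comp_elim, Sum.comp_elim, Sum.elim_comp_inr, Sum.elim_comp_inr] at this
  have hmid : SameType L (Sum.elim d fun _ : Unit => c₁) (Sum.elim d fun _ : Unit => c₂) := by
    have := SameType.comp h (Sum.map (fun b => ⟨d b, hdJ b⟩) id)
    rwa [Sum.elim_comp_map, Sum.elim_comp_map] at this
  exact ((hmove c₁ (aclOn_mono e Set.subset_union_left hG₁)).trans hmid).trans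
    (hmove c₂ (aclOn_mono e Set.subset_union_right hG₂)).symm

/-- If the types over closures of countable parts are realized, then so are the types over
closures of arbitrary co-infinite parts. -/
theorem exists_realizesOn_of_countable (he : IsIndiscernible L e)
    (hM : aclOn L e Set.univ = Set.univ) {J₀ : Set ι} (hJ₀ : J₀.Infinite) (hJ₀c : J₀ᶜ.Infinite)
    (U : Ultrafilter M)
    (hreal : ∀ J ⊆ J₀, J.Countable → J.Infinite → ∃ c, RealizesOn L U (aclOn L e J) c) :
    ∃ c, RealizesOn L U (aclOn L e J₀) c := by
  classical
  by_contra hno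
  push Not at hno
  let S := {J : Set ι // J ⊆ J₀ ∧ J.Countable ∧ J.Infinite}
  have hex : ∀ J : S, ∃ (c : M) (C : Finset ι), (∀ i ∈ C, i ∉ J₀) ∧ c ∈ aclOn L e (J.1 ∪ C) ∧
      RealizesOn L U (aclOn L e J.1) c := by
    intro J
    obtain ⟨c, hc⟩ := hreal J.1 J.2.1 J.2.2.1 J.2.2.2
    obtain ⟨c', C, hC, hc', hcc'⟩ := exists_sameOver_aclOn he (J := J.1) hJ₀c
      (disjoint_compl_left.mono_right J.2.1) (c := c) (hM ▸ Set.mem_univ c)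
    exact ⟨c', C, fun i hi => hC hi, hc', hc.of_sameOver hcc'⟩
  choose c C hC hc hcU using hex
  -- The failure of `c J` over `J₀` involves finitely many parameters, so adding a finite set of
  -- indices to `J` already exhibits it.
  have hstep : ∀ J : S, ∃ J' : S, J.1 ⊆ J'.1 ∧ ¬ RealizesOn L U (aclOn L e J'.1) (c J) := by
    intro J
    by_contra hcon
    push Not at hcon
    refine hno (c J) (RealizesOn.of_finite fun B hBJ₀ hB => ?_)
    obtain ⟨G, hGJ, hG⟩ := exists_finset_aclOn_finite hB hBJ₀
    refine (hcon ⟨J.1 ∪ G, Set.union_subset J.2.1 hGJ, J.2.2.1.union G.countable_toSet,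
      J.2.2.2.mono Set.subset_union_left⟩ Set.subset_union_left).mono ?_
    exact hG.trans (aclOn_mono e Set.subset_union_right)
  choose nxt hsub hnxt using hstep
  obtain ⟨J₁, hJ₁, hJ₁inf, hJ₁c⟩ : ∃ J₁ ⊆ J₀, J₁.Infinite ∧ J₁.Countable := by
    obtain ⟨h, hh⟩ := exists_embedding_of_infinite hJ₀ ℕ
    exact ⟨Set.range h, by rintro _ ⟨n, rfl⟩; exact hh n,
      Set.infinite_range_of_injective h.injective, Set.countable_range h⟩
  let s : ℕ → S := fun n => nxt^[n] ⟨J₁, hJ₁, hJ₁c, hJ₁inf⟩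
  have hs : ∀ n, s (n + 1) = nxt (s n) := fun n => Function.iterate_succ_apply' _ _ _
  have hmono : Monotone fun n => (s n).1 := monotone_nat_of_le_succ fun n => by
    rw [hs]
    exact hsub _
  let Jω : S := ⟨⋃ n, (s n).1, Set.iUnion_subset fun n => (s n).2.1,
    Set.countable_iUnion fun n => (s n).2.2.1, (s 0).2.2.2.mono (Set.subset_iUnion _ 0)⟩
  obtain ⟨G, hGJ, hG⟩ := exists_finset_aclOn (hc Jω)
  -- The finite support of `c Jω` is caught at a finite stage `n`. There `c Jω` and `c (s n)` have
  -- the same type over `aclOn L e J₀`, although only the former realizes `U` at stage `n + 1`.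
  obtain ⟨n, hn⟩ : ∃ n, (G : Set ι) ⊆ (s n).1 ∪ C Jω := by
    have : (G : Set ι) ⊆ ⋃ n, ((s n).1 ∪ (C Jω : Set ι)) := by
      rw [← Set.iUnion_union]
      exact hGJ
    refine Directed.exists_mem_subset_of_finset_subset_biUnion ?_ this
    exact directed_of_isDirected_le fun i j hij => Set.union_subset_union_left _ (hmono hij)
  have hle : ∀ n, aclOn L e (s n).1 ⊆ aclOn L e Jω.1 := fun n =>
    aclOn_mono e (Set.subset_iUnion (fun n => (s n).1) n)
  have h1 : SameOver L (aclOn L e (s n).1) (c Jω) (c (s n)) :=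
    ((hcU Jω).mono (hle n)).sameOver (hcU (s n))
  have h2 : SameOver L (aclOn L e J₀) (c Jω) (c (s n)) :=
    h1.extend he (s n).2.2.2 (hC Jω) (hC (s n)) (aclOn_mono e hn hG) (hc (s n))
  refine hnxt (s n) ?_
  rw [← hs]
  exact ((hcU Jω).mono (hle (n + 1))).of_sameOver (h2.mono (aclOn_mono e (s (n + 1)).2.1))

end Closure

/-! ### Stretching the indiscernible set -/

section Embeddings

variable {L : FirstOrder.Language.{u, v}} {M N : Type w} [L.Structure M] [L.Structure N]

theorem acl_entries_comp {ι κ β : Type*} (e : ι → β → M) (f : κ → ι) :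
    acl L (entries fun k => e (f k)) = aclOn L e (Set.range f) := by
  have : entries (fun k => e (f k)) = Set.range (fam e f) := by
    ext x
    simp [entries, fam]
  rw [this, acl_range, aclOn_range]

theorem acl_entries {ι β : Type*} (e : ι → β → M) :
    acl L (entries e) = aclOn L e Set.univ := by
  rw [← Set.range_id]
  exact acl_entries_comp e id

theorem aclOn_univ {ι β : Type*} (e : ι → β → M) :
    aclOn L e Set.univ = {c | IsAlg L (fam e id) c} := by
  rw [← Set.range_id]
  exact aclOn_range e id

theorem Similar.isIndiscernible {ι ι' β : Type*} [Infinite ι] {e : ι → β → M} {e' : ι' → β → N}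
    (h : Similar L e e') : IsIndiscernible L e' := by
  intro n f g
  obtain ⟨k, -⟩ := exists_embedding_of_infinite (Set.infinite_univ (α := ι)) (Fin n)
  exact (h.sameType k f).symm.trans (h.sameType k g)

theorem isIndiscernible_comp {ι κ β : Type*} {e : ι → β → M} (he : IsIndiscernible L e)
    (f : κ ↪ ι) : IsIndiscernible L fun k => e (f k) :=
  fun _ g h => he.similar.sameType (g.trans f) (h.trans f)

theorem isIndiscernible_range {ι β : Type*} {e : ι → β → M} (he : IsIndiscernible L e) :
    IsIndiscernible L fun i : Set.range e => i.1 := by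
  choose r hr using fun i : Set.range e => i.2
  have hinj : Function.Injective r := fun i j hij => Subtype.ext (by rw [← hr, hij, hr])
  simpa only [Function.Embedding.coeFn_mk, hr] using isIndiscernible_comp he ⟨r, hinj⟩

theorem entries_range {ι β : Type*} (e : ι → β → M) :
    entries (fun i : Set.range e => i.1) = entries e := by
  ext x
  simp [entries]

theorem Similar.of_elementarySubstructure {ι ι' β : Type*} {e : ι → β → M} {e' : ι' → β → N}
    (h : Similar L e e') (S : L.ElementarySubstructure N) (d : ι' → β → S)
    (hd : ∀ i b, (d i b : N) = e' i b) : Similar L e d := by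
  intro n f g
  refine (h n f g).trans ?_
  have := (sameType_embedding S.subtype (fam d g)).symm
  convert this using 1
  funext p
  exact (hd _ _).symm

theorem aclOn_univ_elementarySubstructure {ι κ β : Type*} (e : ι → β → M) (f : κ → ι)
    (S : L.ElementarySubstructure M) (hS : (S : Set M) = aclOn L e (Set.range f))
    (d : κ → β → S) (hd : ∀ k b, (d k b : M) = e (f k) b) :
    aclOn L d Set.univ = Set.univ := by
  rw [aclOn_univ, Set.eq_univ_iff_forall]
  intro c
  have hc : (c : M) ∈ aclOn L e (Set.range f) := hS ▸ c.2
  rw [aclOn_range] at hc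
  refine IsAlg.of_sameType hc ?_
  have := (sameType_embedding S.subtype (Sum.elim (fam d id) fun _ : Unit => c)).symm
  convert this using 1
  funext p
  rcases p with p | p
  · exact (hd _ _).symm
  · rfl

/-- If `M` is the algebraic closure of `e`, then every injective reindexing of `e` into a similar
family extends to an elementary embedding of `M`. -/
theorem Similar.exists_elementaryEmbedding {ι ι' β : Type*} {e : ι → β → M} {e' : ι' → β → N}
    (h : Similar L e e') (hM : aclOn L e Set.univ = Set.univ) (σ : ι ↪ ι') :
    ∃ g : M ↪ₑ[L] N, Set.range g = aclOn L e' (Set.range σ) := by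
  have halg : ∀ m : M, IsAlg L (fam e id) m := by
    intro m
    have : m ∈ aclOn L e Set.univ := hM ▸ Set.mem_univ m
    rwa [aclOn_univ] at this
  obtain ⟨d, hd⟩ := (h.sameType (Function.Embedding.refl ι) σ).exists_extend (id : M → M) halg
  let g : M ↪ₑ[L] N := ⟨d, fun _ φ x => ((hd.comp (Sum.inr ∘ x)) φ).symm⟩
  refine ⟨g, ?_⟩
  rw [aclOn_range]
  refine Set.Subset.antisymm ?_ ?_
  · rintro _ ⟨m, rfl⟩
    refine (halg m).of_sameType ?_
    have := hd.comp (Sum.map id fun _ : Unit => m)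
    rwa [Sum.elim_comp_map, Sum.elim_comp_map] at this
  · rintro c ⟨θ, hc, hfin⟩
    have hsame := h.sameType (Function.Embedding.refl ι) σ
    have hsub : g '' solutions θ (fam e (Function.Embedding.refl ι)) ⊆
        solutions θ (fam e' σ) := by
      rintro _ ⟨m, hm, rfl⟩
      have := hd.comp (Sum.map id fun _ : Unit => m)
      rw [Sum.elim_comp_map, Sum.elim_comp_map] at this
      exact (this θ).1 hm
    -- Surjectivity: corresponding finite solution sets have equal size, so the image fills the
    -- target.
    have heq := hfin.eq_of_subset_of_encard_le' hsub (by
      rw [g.injective.encard_image, hsame.encard_solutions])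
    rw [← heq] at hc
    obtain ⟨m, -, rfl⟩ := hc
    exact ⟨m, rfl⟩

/-- An infinite indiscernible family can be stretched to any index set. -/
theorem IsIndiscernible.exists_similar {ι : Type w} {β : Type*} [Infinite ι] [Nonempty M]
    {e : ι → β → M} (he : IsIndiscernible L e) (ι' : Type w) :
    ∃ (N : Type w) (_ : L.Structure N) (e' : ι' → β → N), Similar L e e' := by
  classical
  have hσ : ∀ F : Finset ι', ∃ σ : ι' → ι, Set.InjOn σ F := by
    intro F
    obtain ⟨k, -⟩ := exists_embedding_of_infinite (Set.infinite_univ (α := ι)) F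
    let i₀ : ι := Classical.arbitrary ι
    refine ⟨fun i => if h : i ∈ F then k ⟨i, h⟩ else i₀, fun i hi j hj hij => ?_⟩
    simpa [Finset.mem_coe.1 hi, Finset.mem_coe.1 hj] using hij
  choose σ hσ using hσ
  -- Containing a given finite set of indices is a `U`-large condition on `F`, so finitely many new
  -- members are represented by distinct old ones almost everywhere.
  let U : Ultrafilter (Finset ι') := Ultrafilter.of atTop
  refine ⟨(U : Filter (Finset ι')).Product fun _ => M, inferInstance,
    fun i b => ((fun F => e (σ F i) b : Finset ι' → M) :
      (U : Filter (Finset ι')).Product fun _ => M), fun n f g φ => ?_⟩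
  have hlos := Ultraproduct.realize_formula_cast (M := fun _ : Finset ι' => M) (u := U) φ
    (fun p F => e (σ F (g p.1)) p.2)
  refine Iff.trans ?_ hlos.symm
  have hev : ∀ᶠ F in (U : Filter (Finset ι')), Finset.univ.map g ⊆ F :=
    Ultrafilter.of_le atTop (eventually_ge_atTop _)
  have hev' : ∀ᶠ F in (U : Filter (Finset ι')), (φ.Realize (fam e f) ↔
      φ.Realize fun p : Fin n × β => e (σ F (g p.1)) p.2) := by
    filter_upwards [hev] with F hF
    refine he n f ⟨fun i => σ F (g i), fun i j hij => g.injective (hσ F ?_ ?_ hij)⟩ φ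
    · exact hF (by simp)
    · exact hF (by simp)
  constructor
  · intro h
    filter_upwards [hev'] with F hF using hF.1 h
  · intro h
    obtain ⟨F, hF, hF'⟩ := (h.and hev').exists
    exact hF'.2 hF

theorem exists_embedding_range_superset {ι ι' : Type w} [Infinite ι] (h : #ι ≤ #ι') {J : Set ι'}
    (hJ : J.Countable) : ∃ σ : ι ↪ ι', J ⊆ Set.range σ := by
  obtain ⟨σ₀⟩ := h
  have hcard : #ι = #(Set.range σ₀ ∪ J : Set ι') := by
    refine le_antisymm ?_ ?_
    · rw [← Cardinal.mk_range_eq σ₀ σ₀.injective]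
      exact Cardinal.mk_le_mk_of_subset Set.subset_union_left
    · refine (Cardinal.mk_union_le _ _).trans ?_
      rw [Cardinal.mk_range_eq σ₀ σ₀.injective]
      exact Cardinal.add_le_of_le (Cardinal.aleph0_le_mk ι) le_rfl
        (hJ.le_aleph0.trans (Cardinal.aleph0_le_mk ι))
  obtain ⟨E⟩ := Cardinal.eq.1 hcard
  refine ⟨E.toEmbedding.trans (Function.Embedding.subtype _), fun j hj => ?_⟩
  exact ⟨E.symm ⟨j, Or.inr hj⟩, by simp⟩

/-- Finitely many parameters of the closure lie in an elementary copy of `M` inside it, which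
supplies the Tarski–Vaught witness. -/
theorem Similar.exists_elementarySubstructure_aclOn_univ {ι ι' : Type w} {β : Type*} [Infinite ι]
    {e : ι → β → M} {e' : ι' → β → N} (h : Similar L e e') (hM : aclOn L e Set.univ = Set.univ)
    (hle : #ι ≤ #ι') :
    ∃ S : L.ElementarySubstructure N, (S : Set N) = aclOn L e' Set.univ := by
  refine exists_elementarySubstructure _ fun A hA hAfin φ hφ => ?_
  obtain ⟨G, -, hG⟩ := exists_finset_aclOn_finite hAfin hA
  obtain ⟨σ, hσ⟩ := exists_embedding_range_superset hle G.countable_toSet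
  obtain ⟨g, hg⟩ := h.exists_elementaryEmbedding hM σ
  have hAg : A ⊆ Set.range g := hg ▸ hG.trans (aclOn_mono e' hσ)
  choose a ha using fun x : A => hAg x.2
  have hsame := sameType_embedding g a
  have hga : g ∘ a = Subtype.val := funext ha
  rw [← hga] at hφ ⊢
  obtain ⟨m, hm⟩ := hsame.symm.nonempty_solutions hφ
  refine ⟨g m, ?_, aclOn_mono e' (Set.subset_univ _) (hg ▸ Set.mem_range_self m)⟩
  have := sameType_embedding g (Sum.elim a fun _ : Unit => m)
  rw [Sum.comp_elim] at this
  exact (this φ).1 hm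

/-- A countable `J` lies in the range of an embedding of `ι`, so `aclOn L e' J` lies in an
elementary copy of `M`; the type is pulled back to `M` and realized there by saturation. -/
theorem Similar.exists_realizesOn_countable {ι ι' : Type w} {β : Type*} [Infinite ι]
    {e : ι → β → M} {e' : ι' → β → N} (h : Similar L e e') (hM : aclOn L e Set.univ = Set.univ)
    (hsat : IsSaturated L M) (hle : #ι ≤ #ι') (U : Ultrafilter N) {J : Set ι'} (hJ : J.Countable)
    (hcard : #(aclOn L e' J) < #M) : ∃ c, RealizesOn L U (aclOn L e' J) c := by
  classical
  obtain ⟨σ, hσ⟩ := exists_embedding_range_superset hle hJ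
  obtain ⟨g, hg⟩ := h.exists_elementaryEmbedding hM σ
  have hJg : aclOn L e' J ⊆ Set.range g := hg ▸ aclOn_mono e' hσ
  let B : Set M := g ⁻¹' aclOn L e' J
  have hB : #B < #M := by
    refine lt_of_le_of_lt ?_ hcard
    exact Cardinal.mk_le_of_injective (f := fun b : B => (⟨g b.1, b.2⟩ : aclOn L e' J))
      fun b b' hb => Subtype.ext (g.injective (congrArg Subtype.val hb))
  obtain ⟨c, hc⟩ := hsat.exists_realization hB
    {φ | solutions φ (g ∘ (Subtype.val : B → M)) ∈ U} (by
      intro q hq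
      let Φ : L.Formula (B ⊕ Unit) := Formula.iInf fun φ : q => φ.1
      have hΦ : ∀ (P : Type w) [L.Structure P] (b : B → P),
          solutions Φ b = ⋂ φ ∈ q, solutions φ b := by
        intro P _ b
        ext x
        simp [Φ, solutions, Formula.realize_iInf]
      have hU : solutions Φ (g ∘ (Subtype.val : B → M)) ∈ U := by
        rw [hΦ]
        exact (Filter.biInter_finset_mem (f := (U : Filter N)) (s := fun φ => solutions φ
          (g ∘ (Subtype.val : B → M))) q).2 fun φ hφ => hq hφ
      obtain ⟨m, hm⟩ := (sameType_embedding g (Subtype.val : B → M)).symm.nonempty_solutions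
        (U.nonempty_of_mem hU)
      rw [hΦ] at hm
      exact ⟨m, by simpa using hm⟩)
  choose r hr using fun a : aclOn L e' J => hJg a.2
  let r' : aclOn L e' J → B := fun a => ⟨r a, by
    change g (r a) ∈ aclOn L e' J
    rw [hr]
    exact a.2⟩
  have hr' : (g ∘ (Subtype.val : B → M)) ∘ r' = Subtype.val := funext hr
  refine ⟨g c, fun φ hφ => ?_⟩
  rw [← hr', ← solutions_relabel] at hφ ⊢
  have h1 := hc _ hφ
  have := sameType_embedding g (Sum.elim (Subtype.val : B → M) fun _ : Unit => c)
  rw [Sum.comp_elim] at this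
  exact (this _).1 h1

theorem Similar.isSaturated {ι ι' : Type w} {β : Type*} [Infinite ι]
    {e : ι → β → M} {e' : ι' → β → N} (h : Similar L e e') (hM : aclOn L e Set.univ = Set.univ)
    (hN : aclOn L e' Set.univ = Set.univ) (hsat : IsSaturated L M) (hle : #ι ≤ #ι')
    (hunc : ℵ₀ < #ι') (hcard : ∀ J : Set ι', J.Countable → #(aclOn L e' J) < #M)
    (hN' : #N = #ι') : IsSaturated L N := by
  have hι' : Infinite ι' := Cardinal.infinite_iff.2 hunc.le
  refine isSaturated_of_realizesOn fun A hA U => ?_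
  obtain ⟨J, -, hJ, hAJ⟩ := exists_small_index (e := e') (Set.infinite_univ (α := ι')) (A := A)
    (hN ▸ Set.subset_univ A) (by rwa [Cardinal.mk_univ, ← hN'])
  rw [Cardinal.mk_univ] at hJ
  -- `J` may be finite, while passing from countable parts needs an infinite index set. As `ι'` is
  -- uncountable, adjoining countably many indices keeps it small.
  obtain ⟨k, -⟩ := exists_embedding_of_infinite (Set.infinite_univ (α := ι')) ℕ
  have hlt : #(J ∪ Set.range k : Set ι') < #ι' := by
    refine (Cardinal.mk_union_le _ _).trans_lt (Cardinal.add_lt_of_lt hunc.le hJ ?_)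
    exact (Set.countable_range k).le_aleph0.trans_lt hunc
  obtain ⟨c, hc⟩ := exists_realizesOn_of_countable h.isIndiscernible hN (J₀ := J ∪ Set.range k)
    ((Set.infinite_range_of_injective k.injective).mono Set.subset_union_right)
    (by
      rw [Set.compl_eq_univ_sdiff]
      exact infinite_sdiff_of_mk_lt Set.infinite_univ (by rwa [Cardinal.mk_univ]))
    U fun J' _ hJ' _ => h.exists_realizesOn_countable hM hsat hle U hJ' (hcard J' hJ')
  exact ⟨c, hc.mono (hAJ.trans (aclOn_mono e' Set.subset_union_left))⟩

theorem Similar.injective_coord {ι ι' β : Type*} [Infinite ι] {e : ι → β → M} {e' : ι' → β → N}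
    (h : Similar L e e') {b : β} (hb : Function.Injective fun i => e i b) :
    Function.Injective fun i => e' i b := by
  intro i j hij
  by_contra hne
  obtain ⟨k, -⟩ := exists_embedding_of_infinite (Set.infinite_univ (α := ι)) (Fin 2)
  let l : Fin 2 ↪ ι' := ⟨![i, j], by
    intro x y hxy
    fin_cases x <;> fin_cases y <;> simp_all [eq_comm]⟩
  have h1 := ((h.sameType k l).eq_iff (0, b) (1, b)).2 hij
  exact zero_ne_one (k.injective (hb h1))

/-- A coordinate separating one pair of members separates every pair. This bounds closures below by
the number of indices. -/
theorem IsIndiscernible.exists_injective_coord {ι β : Type*} [Nontrivial ι] {e : ι → β → M}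
    (he : IsIndiscernible L e) (hinj : Function.Injective e) :
    ∃ b, Function.Injective fun i => e i b := by
  obtain ⟨i, j, hij⟩ := exists_pair_ne ι
  obtain ⟨b, hb⟩ := Function.ne_iff.1 (hinj.ne hij)
  refine ⟨b, fun i' j' hij' => ?_⟩
  by_contra hne
  have hpair : ∀ i j : ι, i ≠ j → Function.Injective ![i, j] := by
    intro i j hij x y hxy
    fin_cases x <;> fin_cases y <;> simp_all [eq_comm]
  exact hb (((he.similar.sameType ⟨_, hpair i j hij⟩ ⟨_, hpair i' j' hne⟩).eq_iff
    (0, b) (1, b)).2 hij')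

end Embeddings

/-! ### Cardinality of closures -/

section Cardinality

variable {L : FirstOrder.Language.{u, v}} {M : Type max u v} [L.Structure M]

theorem mk_formula_le (α : Type max u v) : #(L.Formula α) ≤ max (theoryCard L) #α := by
  have h1 : #(L.Formula α) ≤ #(Σ n, L.BoundedFormula α n) :=
    Cardinal.mk_le_of_injective (f := fun φ => ⟨0, φ⟩) fun φ ψ h => by simpa using h
  refine h1.trans (BoundedFormula.card_le.trans ?_)
  simp only [Cardinal.lift_id]
  refine max_le ((le_max_left _ _).trans (le_max_left _ _)) ?_
  refine Cardinal.add_le_of_le ((le_max_left _ _).trans (le_max_left _ _)) ?_ ?_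
  · exact le_max_right _ _
  · exact (le_max_right _ _).trans (le_max_left _ _)

/-- The closure is a union of finite solution sets, one for each algebraic formula over the entries.
-/
theorem mk_aclOn_le {ι β : Type max u v} (e : ι → β → M) (J : Set ι) :
    #(aclOn L e J) ≤ max (theoryCard L) (#J * #β) := by
  have hℵ : ℵ₀ ≤ theoryCard L := le_max_left _ _
  let F := {φ : L.Formula ((J × β) ⊕ Unit) // (solutions φ (fam e ((↑) : J → ι))).Finite}
  have hF : #F ≤ max (theoryCard L) (#J * #β) := by
    refine (Cardinal.mk_subtype_le _).trans ?_
    have := mk_formula_le (L := L) ((J × β) ⊕ PUnit.{max u v + 1})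
    have h2 : #(L.Formula ((J × β) ⊕ Unit)) ≤ #(L.Formula ((J × β) ⊕ PUnit.{max u v + 1})) := by
      exact (Cardinal.mk_congr (BoundedFormula.relabelEquiv (k := 0)
        (Equiv.sumCongr (Equiv.refl (J × β)) Equiv.punitEquivPUnit))).le
    refine (h2.trans this).trans (max_le (le_max_left _ _) ?_)
    rw [Cardinal.mk_sum, Cardinal.mk_prod]
    simp only [Cardinal.lift_id, Cardinal.mk_punit]
    exact Cardinal.add_le_of_le (hℵ.trans (le_max_left _ _)) (le_max_right _ _)
      (Cardinal.one_le_aleph0.trans (hℵ.trans (le_max_left _ _)))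
  have hsub : aclOn L e J ⊆ ⋃ φ : F, solutions φ.1 (fam e ((↑) : J → ι)) := by
    rintro c ⟨φ, hc, hfin⟩
    exact Set.mem_iUnion.2 ⟨⟨φ, hfin⟩, hc⟩
  refine (Cardinal.mk_le_mk_of_subset hsub).trans ?_
  refine Cardinal.mk_iUnion_le_sum_mk.trans ?_
  refine (Cardinal.sum_le_sum _ (fun _ => ℵ₀) fun φ =>
    (Cardinal.lt_aleph0_iff_set_finite.2 φ.2).le).trans ?_
  rw [Cardinal.sum_const']
  exact Cardinal.mul_le_of_le (hℵ.trans (le_max_left _ _)) hF (hℵ.trans (le_max_left _ _))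

end Cardinality

/-! ### Changing the cardinal -/

section Main

variable {L : FirstOrder.Language.{u, v}} {T : L.Theory} {μ κ : Cardinal.{max u v}}
  {M : Type max u v} [L.Structure M]

theorem mk_aclOn_lt {ι : Type max u v} (hμ : μ ≤ theoryCard L) (hκ : theoryCard L < κ)
    (e : ι → μ.ord.ToType → M) {J : Set ι} (hJ : #J < κ) : #(aclOn L e J) < κ := by
  refine (mk_aclOn_le e J).trans_lt (max_lt hκ ?_)
  rw [Cardinal.mk_toType, Cardinal.card_ord]
  exact Cardinal.mul_lt_of_lt ((le_max_left _ _).trans hκ.le) hJ (hμ.trans_lt hκ)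

theorem mk_aclOn_eq {ι K : Type max u v} (hμ : μ ≤ theoryCard L)
    {e : ι → μ.ord.ToType → M} (f : K ↪ ι) (hK : theoryCard L ≤ #K) {b : μ.ord.ToType}
    (hb : Function.Injective fun i => e i b) : #(aclOn L e (Set.range f)) = #K := by
  have hℵ : ℵ₀ ≤ #K := (le_max_left _ _).trans hK
  refine le_antisymm ?_ ?_
  · refine (mk_aclOn_le e _).trans (max_le hK ?_)
    rw [Cardinal.mk_toType, Cardinal.card_ord, Cardinal.mk_range_eq f f.injective]
    exact Cardinal.mul_le_of_le hℵ le_rfl (hμ.trans hK)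
  · exact Cardinal.mk_le_of_injective
      (f := fun k => (⟨e (f k) b, entry_mem_aclOn e (Set.mem_range_self k) b⟩ : aclOn L e (Set.range f)))
      fun k k' h => f.injective (hb (congrArg Subtype.val h))

namespace Witnesses

variable {I : Set (μ.ord.ToType → M)}

theorem aclOn_univ (W : Witnesses T μ κ M I) :
    aclOn L (fun i : I => i.1) Set.univ = Set.univ := by
  rw [← acl_entries, W.acl_eq]

theorem le_mk (W : Witnesses T μ κ M I) (hμ : μ ≤ theoryCard L) (hκ : theoryCard L < κ) :
    κ ≤ #I := by
  by_contra h
  have := mk_aclOn_lt (J := Set.univ) hμ hκ (fun i : I => i.1)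
    (by rw [Cardinal.mk_univ]; exact not_le.1 h)
  rw [W.aclOn_univ, Cardinal.mk_univ, W.card_eq] at this
  exact lt_irrefl _ this

theorem infinite (W : Witnesses T μ κ M I) (hμ : μ ≤ theoryCard L) (hκ : theoryCard L < κ) :
    Infinite I :=
  Cardinal.infinite_iff.2 (((le_max_left _ _).trans hκ.le).trans (W.le_mk hμ hκ))

theorem exists_injective_coord (W : Witnesses T μ κ M I) (hμ : μ ≤ theoryCard L)
    (hκ : theoryCard L < κ) : ∃ b, Function.Injective fun i : I => i.1 b := by
  have := W.infinite hμ hκ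
  exact W.indiscernible.exists_injective_coord Subtype.val_injective

theorem mk_eq (W : Witnesses T μ κ M I) (hμ : μ ≤ theoryCard L) (hκ : theoryCard L < κ) :
    #I = κ := by
  refine le_antisymm ?_ (W.le_mk hμ hκ)
  obtain ⟨b, hb⟩ := W.exists_injective_coord hμ hκ
  rw [← W.card_eq]
  exact Cardinal.mk_le_of_injective hb

/-- The closure of a large part of the indiscernible set is a saturated elementary substructure
which is again the algebraic closure of an indiscernible family. -/
theorem exists_saturated_elementarySubstructure (W : Witnesses T μ κ M I) (hμ : μ ≤ theoryCard L)
    (hκ : theoryCard L < κ) {K : Type max u v} (hK : theoryCard L ≤ #K) (f : K ↪ I) :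
    ∃ N : L.ElementarySubstructure M, (N : Set M) = acl L (entries fun k => (f k).1) ∧
      N ⊨ T ∧ #N = #K ∧ IsSaturated L N ∧
      ∃ d : K → μ.ord.ToType → N, (∀ k i, (d k i : M) = (f k).1 i) ∧ Function.Injective d ∧
        IsIndiscernible L d ∧ acl L (entries d) = Set.univ := by
  let e : I → μ.ord.ToType → M := fun i => i.1
  have hKinf : Infinite K := Cardinal.infinite_iff.2 ((le_max_left _ _).trans hK)
  have hIinf := W.infinite hμ hκ
  have hrange : (Set.range f).Infinite := Set.infinite_range_of_injective f.injective
  have hmk : #(Set.range f) = #K := Cardinal.mk_range_eq f f.injective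
  obtain ⟨N, hN⟩ := exists_elementarySubstructure_aclOn W.indiscernible W.aclOn_univ hrange
  obtain ⟨b, hb⟩ := W.exists_injective_coord hμ hκ
  have hNK : #N = #K := by
    rw [← mk_aclOn_eq (L := L) (e := e) hμ f hK hb, ← hN]
    rfl
  have hmem : ∀ k i, (f k).1 i ∈ N := fun k i => by
    rw [← SetLike.mem_coe, hN]
    exact entry_mem_aclOn e (Set.mem_range_self k) i
  let d : K → μ.ord.ToType → N := fun k i => ⟨(f k).1 i, hmem k i⟩
  have hsim : Similar L (fun k => e (f k)) d :=
    (isIndiscernible_comp W.indiscernible f).similar.of_elementarySubstructure N d fun _ _ => rfl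
  refine ⟨N, ?_, ?_, hNK, ?_, d, fun _ _ => rfl, ?_, ?_, ?_⟩
  · rw [hN, ← acl_entries_comp]
  · exact (N.subtype.theory_model_iff T).2 W.model
  · refine isSaturated_of_coe_eq_aclOn W.indiscernible W.aclOn_univ hrange N hN
      -- Since `|J₀| < |K| ≤ κ`, the closure of `J₀` has size below `κ`, so saturation of `M`
      -- applies.
      (hNK.trans hmk.symm) fun J₀ _ hJ₀ U => W.saturated.exists_realizesOn ?_ U
    rw [W.card_eq]
    refine mk_aclOn_lt hμ hκ _ (hJ₀.trans_le ?_)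
    rw [← W.mk_eq hμ hκ]
    exact Cardinal.mk_set_le _
  · intro k k' h
    refine f.injective (Subtype.ext (funext fun i => ?_))
    exact congrArg Subtype.val (congrFun h i)
  · exact hsim.isIndiscernible
  · rw [acl_entries]
    exact aclOn_univ_elementarySubstructure e f N hN d fun _ _ => rfl

theorem isAlmostIndiscernible_of_le (W : Witnesses T μ κ M I) (hμ : μ ≤ theoryCard L)
    (hκ : theoryCard L < κ) {κ' : Cardinal.{max u v}} (hκ' : theoryCard L < κ') (hle : κ' ≤ κ) :
    IsAlmostIndiscernible T μ κ' := by
  rw [← W.mk_eq hμ hκ, Cardinal.le_mk_iff_exists_set] at hle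
  obtain ⟨K, rfl⟩ := hle
  obtain ⟨N, -, hT, hNK, hsat, d, -, -, hd, hacl⟩ :=
    W.exists_saturated_elementarySubstructure hμ hκ hκ'.le (Function.Embedding.subtype (· ∈ K))
  exact ⟨N, inferInstance, Set.range d, hT, hNK, hsat, isIndiscernible_range hd, by
    rw [entries_range, hacl]⟩

theorem isAlmostIndiscernible_of_ge (W : Witnesses T μ κ M I) (hμ : μ ≤ theoryCard L)
    (hκ : theoryCard L < κ) {κ' : Cardinal.{max u v}} (hle : κ ≤ κ') :
    IsAlmostIndiscernible T μ κ' := by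
  have hκ' := hκ.trans_le hle
  have hℵ : ℵ₀ ≤ theoryCard L := le_max_left _ _
  have hIinf := W.infinite hμ hκ
  have hMne : Nonempty M := by
    rw [← Cardinal.mk_ne_zero_iff, W.card_eq]
    exact (zero_le.trans_lt hκ).ne'
  obtain ⟨b, hb⟩ := W.exists_injective_coord hμ hκ
  have hI : #I ≤ #κ'.out := by rwa [Cardinal.mk_out, W.mk_eq hμ hκ]
  obtain ⟨P, _, e', he'⟩ := W.indiscernible.exists_similar κ'.out
  obtain ⟨N, hN⟩ := he'.exists_elementarySubstructure_aclOn_univ W.aclOn_univ hI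
  let d : κ'.out → μ.ord.ToType → N := fun k i => ⟨e' k i, by
    rw [← SetLike.mem_coe, hN]
    exact entry_mem_aclOn e' (Set.mem_univ k) i⟩
  have hsim := he'.of_elementarySubstructure N d fun _ _ => rfl
  have hd : AlmInd.aclOn L d Set.univ = Set.univ :=
    aclOn_univ_elementarySubstructure e' id N (by rw [hN, Set.range_id]) d fun _ _ => rfl
  have hNκ' : #N = κ' := by
    have := mk_aclOn_eq (L := L) hμ (Function.Embedding.refl κ'.out)
      (by rw [Cardinal.mk_out]; exact hκ'.le) (hsim.injective_coord hb)
    rwa [Function.Embedding.coe_refl, Set.range_id, hd, Cardinal.mk_univ, Cardinal.mk_out] at this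
  obtain ⟨σ⟩ := hI
  obtain ⟨g, -⟩ := hsim.exists_elementaryEmbedding W.aclOn_univ σ
  refine ⟨N, inferInstance, Set.range d, (g.theory_model_iff T).1 W.model, hNκ', ?_,
    isIndiscernible_range hsim.isIndiscernible, by rw [entries_range, acl_entries, hd]⟩
  refine hsim.isSaturated W.aclOn_univ hd W.saturated ⟨σ⟩ ?_ (fun J hJ => ?_) ?_
  · rw [Cardinal.mk_out]
    exact hℵ.trans_lt hκ'
  · rw [W.card_eq]
    exact mk_aclOn_lt hμ hκ d (hJ.le_aleph0.trans_lt (hℵ.trans_lt hκ))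
  · rw [hNκ', Cardinal.mk_out]

end Witnesses

theorem IsAlmostIndiscernible.change_card (h : IsAlmostIndiscernible T μ κ)
    (hμ : μ ≤ theoryCard L) (hκ : theoryCard L < κ) {κ' : Cardinal.{max u v}}
    (hκ' : theoryCard L < κ') : IsAlmostIndiscernible T μ κ' := by
  obtain ⟨M, _, I, W⟩ := h
  rcases le_total κ' κ with hle | hle
  · exact W.isAlmostIndiscernible_of_le hμ hκ hκ' hle
  · exact W.isAlmostIndiscernible_of_ge hμ hκ hle

end Main

end AlmInd

theorem mainTheorem9 (L : FirstOrder.Language.{u, v}) (T : L.Theory) (hT : T.IsComplete)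
    (τ : Cardinal.{max u v}) (hτ : τ = AlmInd.theoryCard L)
    (μ : Cardinal.{max u v}) (hμ : μ ≤ τ) :
    -- (a)
    ((∃ κ : Cardinal.{max u v}, τ < κ ∧ AlmInd.IsAlmostIndiscernible T μ κ) ↔
      AlmInd.IsAlmostIndiscernible T μ (Order.succ τ)) ∧
    (AlmInd.IsAlmostIndiscernible T μ (Order.succ τ) ↔
      ∀ κ' : Cardinal.{max u v}, τ < κ' → AlmInd.IsAlmostIndiscernible T μ κ') ∧
    -- (b)
    (∀ κ : Cardinal.{max u v}, τ < κ →
      ∀ (M : Type (max u v)) [L.Structure M] (I : Set (μ.ord.ToType → M)),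
        AlmInd.Witnesses T μ κ M I →
        -- `I` can be enumerated without repetition as `(e α)` for `α < κ`,
        Cardinal.mk I = κ ∧
        -- and for each sequence `(e α)`, `α < τ`, of distinct elements of `I`, its algebraic
        -- closure is an elementary substructure `N` with the stated properties.
        ∀ e : τ.ord.ToType ↪ I, ∃ N : L.ElementarySubstructure M,
          (N : Set M) = AlmInd.acl L (AlmInd.entries (fun α => (e α).1)) ∧
          N ⊨ T ∧ Cardinal.mk N = τ ∧ AlmInd.IsSaturated L N ∧
          ∃ e' : τ.ord.ToType → μ.ord.ToType → N,
            (∀ α i, (e' α i : M) = (e α).1 i) ∧ Function.Injective e' ∧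
            AlmInd.IsIndiscernible L e' ∧
            AlmInd.acl L (AlmInd.entries e') = Set.univ) := by
  subst hτ
  refine ⟨⟨fun ⟨κ, hκ, h⟩ => h.change_card hμ hκ (Order.lt_succ _),
    fun h => ⟨_, Order.lt_succ _, h⟩⟩,
    ⟨fun h κ' hκ' => h.change_card hμ (Order.lt_succ _) hκ', fun h => h _ (Order.lt_succ _)⟩, ?_⟩
  intro κ hκ M _ I W
  refine ⟨W.mk_eq hμ hκ, fun e => ?_⟩
  have hmk : Cardinal.mk (AlmInd.theoryCard L).ord.ToType = AlmInd.theoryCard L := by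
    rw [Cardinal.mk_toType, Cardinal.card_ord]
  have := W.exists_saturated_elementarySubstructure hμ hκ hmk.ge e
  rwa [hmk] at this
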